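/- Let $N=2j\ge 0$ be an integer, let $q\in\mathbb C\setminus\{0\}$ be not a root of unity, fix a square root $q^{1/2}$ of $q$, and put $[k]_q=\frac{q^k-q^{-k}}{q-q^{-1}}$ and $(u;q)_n=\prod_{i=0}^{n-1}(1-uq^i)$, $(u_1,\dots,u_m;q)_n=\prod_{s}(u_s;q)_n$. Consider the irreducible representation of $U_q(\mathfrak{su}(2))$ on $\mathbb C^{2j+1}$ with basis $|0\rangle,\dots,|2j\rangle$ given by $$E|n\rangle=|n-1\rangle,\quad E|0\rangle=0,\qquad F|n\rangle=[2j-n]_q[n+1]_q|n+1\rangle\quad(F|2j\rangle=0),\qquad K|n\rangle=q^{j-n}|n\rangle ,$$ with $q^{j-n}=(q^{1/2})^{2j-2n}$, and with Casimir element $C=(q-q^{-1})^2\big(EF+[H]_q[H-1]_q\big)+q+q^{-1}$, $K=q^H$. Let $a,b,c\in\mathbb C$ with $a\neq0$, $b\ne0$, and suppose that $q^{2m}+a\neq 0$ for all integers $-2j-1\le m\le 2j+2$ (that is, all denominators below are invertible in the representation). Let $$\mathcal Y=E+K^2\,\frac{\big(\frac{(1-a)(a-bc)}{a}+(b+c)C\big)(K^4-a)+\big((b+c)(a-1)+(a-bc)C\big)(q+q^{-1})K^2}{(q-q^{-1})(q^{-2}K^4+a)(q^2K^4+a)}$$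 $$\qquad+\,qK^2\,\frac{(a^2+aqCK^2+q^2K^4)(bqK^2+a)(qK^2-b)(qK^2-c)(qcK^2+a)}{a(K^4+a)(q^2K^4+a)^2(q^4K^4+a)}\,F .$$ Suppose further that $bq^{2i+1-2j}\neq1$ and $cq^{2i+1-2j}\ne1$ for $0\le i<2j$ (so that the $q$-Racah polynomials below are defined). For $0\le x\le 2j$ and $0\le n\le 2j$ put $\mu(x)=q^{-2x}-\frac{bc}{a}q^{2x-4j}$, $$\lambda_x=\frac{q^{2j}\mu(x)}{q-q^{-1}},$$ $$p_n(x)=\frac{q^{2jn}}{(q-q^{-1})^n}\,\frac{(bq^{1-2j},cq^{1-2j},q^{-4j};q^2)_n}{(-aq^{2n-4j};q^2)_n}\;R_n\Big(\mu(x);\,bq^{-2j-1},\,-\tfrac ab q^{-2j-1},\,q^{-2-4j},\,-\tfrac{bc}{a}\,\Big|\,q^2\Big),$$ where $R_n$ is the $q$-Racah polynomial $$R_n\big(q^{-x}+\gamma\delta q^{x+1};\alpha,\beta,\gamma,\delta\,|\,q\big)=\sum_{k=0}^n\frac{(q^{-n},\alpha\beta q^{n+1},q^{-x},\gamma\delta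 q^{x+1};q)_k}{(\alpha q,\beta\delta q,\gamma q,q;q)_k}\,q^k .$$ Then for every $x=0,\dots,2j$ the vector $|p(x)\rangle=\sum_{n=0}^{2j}p_n(x)|n\rangle$ is nonzero and satisfies $\mathcal Y|p(x)\rangle=\lambda_x|p(x)\rangle$. Conversely, every eigenvector of $\mathcal Y$ is, for some $x\in\{0,\dots,2j\}$, a nonzero scalar multiple of $|p(x)\rangle$, with eigenvalue $\lambda_x$. -/

import Mathlib

open scoped Matrix

/-- The `q`-shifted factorial `(a; q)_n = ∏_{i < n} (1 - a q^i)`. -/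
noncomputable def qPoch (a q : ℂ) (n : ℕ) : ℂ :=
  ∏ i ∈ Finset.range n, (1 - a * q ^ i)

/-- The `q`-number `[k]_q = (q^k - q^{-k}) / (q - q⁻¹)`. -/
noncomputable def qNum (q : ℂ) (k : ℤ) : ℂ :=
  (q ^ k - q ^ (-k)) / (q - q⁻¹)

/-- The `q`-Racah polynomial `R_n(X; α, β, γ, δ | q)`, a polynomial of degree at most `n` in `X`.
The product over `i` is `(q^{-x}, γ δ q^{x+1}; q)_k` written in the variable
`X = q^{-x} + γ δ q^{x+1}`; see `qRacah_eq_hypergeometric`. -/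
noncomputable def qRacah (n : ℕ) (X α β γ δ q : ℂ) : ℂ :=
  ∑ k ∈ Finset.range (n + 1),
    qPoch (q ^ (-(n : ℤ))) q k * qPoch (α * β * q ^ (n + 1)) q k *
        (∏ i ∈ Finset.range k, (1 - X * q ^ i + γ * δ * q ^ (2 * i + 1))) /
      (qPoch (α * q) q k * qPoch (β * δ * q) q k * qPoch (γ * q) q k * qPoch q q k) * q ^ k

/-- At the lattice point `X = q^{-x} + γ δ q^{x+1}`, the polynomial `R_n` is the usual terminating
basic hypergeometric series
`₄φ₃(q^{-n}, α β q^{n+1}, q^{-x}, γ δ q^{x+1}; α q, β δ q, γ q; q, q)`. -/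
theorem qRacah_eq_hypergeometric (n x : ℕ) (α β γ δ q : ℂ) (hq : q ≠ 0) :
    qRacah n (q ^ (-(x : ℤ)) + γ * δ * q ^ (x + 1)) α β γ δ q =
      ∑ k ∈ Finset.range (n + 1),
        qPoch (q ^ (-(n : ℤ))) q k * qPoch (α * β * q ^ (n + 1)) q k *
            qPoch (q ^ (-(x : ℤ))) q k * qPoch (γ * δ * q ^ (x + 1)) q k /
          (qPoch (α * q) q k * qPoch (β * δ * q) q k * qPoch (γ * q) q k * qPoch q q k) *
          q ^ k := by
  unfold qRacah
  refine Finset.sum_congr rfl fun k _ => ?_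
  have key : (∏ i ∈ Finset.range k,
        (1 - (q ^ (-(x : ℤ)) + γ * δ * q ^ (x + 1)) * q ^ i + γ * δ * q ^ (2 * i + 1))) =
      qPoch (q ^ (-(x : ℤ))) q k * qPoch (γ * δ * q ^ (x + 1)) q k := by
    unfold qPoch
    rw [← Finset.prod_mul_distrib]
    refine Finset.prod_congr rfl fun i _ => ?_
    rw [zpow_neg, zpow_natCast]
    have hx : q ^ x ≠ 0 := pow_ne_zero _ hq
    field_simp
    ring
  rw [key]
  ring

namespace UqSu2

/-! The irreducible representation of `U_q(su(2))` of spin `j = N / 2` on `ℂ^{2j+1}`, with basis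
`|0⟩, …, |N⟩`. The parameter `r` is a square root of `q`, needed for half-integer `j`. -/

/-- `E |n⟩ = |n-1⟩`, `E |0⟩ = 0`. -/
def E (N : ℕ) : Matrix (Fin (N + 1)) (Fin (N + 1)) ℂ :=
  Matrix.of fun m n => if (m : ℕ) + 1 = n then 1 else 0

/-- `F |n⟩ = [2j-n]_q [n+1]_q |n+1⟩`. -/
noncomputable def F (q : ℂ) (N : ℕ) : Matrix (Fin (N + 1)) (Fin (N + 1)) ℂ :=
  Matrix.of fun m n =>
    if (m : ℕ) = n + 1 then qNum q ((N : ℤ) - (n : ℕ)) * qNum q ((n : ℕ) + 1) else 0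

/-- `K |n⟩ = q^{j-n} |n⟩`, where `q^{j-n} = r^{N-2n}`. -/
noncomputable def K (r : ℂ) (N : ℕ) : Matrix (Fin (N + 1)) (Fin (N + 1)) ℂ :=
  Matrix.diagonal fun n => r ^ ((N : ℤ) - 2 * (n : ℕ))

/-- The Casimir element `C = (q - q⁻¹)² (E F + [H]_q [H-1]_q) + q + q⁻¹`, with `K = q^H`. -/
noncomputable def casimir (r q : ℂ) (N : ℕ) : Matrix (Fin (N + 1)) (Fin (N + 1)) ℂ :=
  (q - q⁻¹) ^ 2 •
      (E N * F q N +
        ((q - q⁻¹)⁻¹ • (K r N - (K r N)⁻¹)) *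
          ((q - q⁻¹)⁻¹ • (q⁻¹ • K r N - q • (K r N)⁻¹))) +
    (q + q⁻¹) • (1 : Matrix (Fin (N + 1)) (Fin (N + 1)) ℂ)

/-- The term `f₂(K, C)` of `𝒴`. All factors commute with one another. -/
noncomputable def f₂ (r q a b c : ℂ) (N : ℕ) : Matrix (Fin (N + 1)) (Fin (N + 1)) ℂ :=
  let k := K r N
  let C := casimir r q N
  let I : Matrix (Fin (N + 1)) (Fin (N + 1)) ℂ := 1
  k ^ 2 *
    ((((1 - a) * (a - b * c) / a) • I + (b + c) • C) * (k ^ 4 - a • I) +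
      (((b + c) * (a - 1)) • I + (a - b * c) • C) * ((q + q⁻¹) • k ^ 2)) *
    ((q - q⁻¹) • ((q⁻¹ ^ 2 • k ^ 4 + a • I) * (q ^ 2 • k ^ 4 + a • I)))⁻¹

/-- The coefficient `f₃(K, C)` of `F` in `𝒴`. All factors commute with one another. -/
noncomputable def f₃ (r q a b c : ℂ) (N : ℕ) : Matrix (Fin (N + 1)) (Fin (N + 1)) ℂ :=
  let k := K r N
  let C := casimir r q N
  let I : Matrix (Fin (N + 1)) (Fin (N + 1)) ℂ := 1
  q • k ^ 2 *
    ((a ^ 2 • I + (a * q) • (C * k ^ 2) + q ^ 2 • k ^ 4) * ((b * q) • k ^ 2 + a • I) *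
      (q • k ^ 2 - b • I) * (q • k ^ 2 - c • I) * ((q * c) • k ^ 2 + a • I)) *
    (a • ((k ^ 4 + a • I) * (q ^ 2 • k ^ 4 + a • I) ^ 2 * (q ^ 4 • k ^ 4 + a • I)))⁻¹

/-- The operator `𝒴 = E + f₂(K, C) + f₃(K, C) F`. -/
noncomputable def Y (r q a b c : ℂ) (N : ℕ) : Matrix (Fin (N + 1)) (Fin (N + 1)) ℂ :=
  E N + f₂ r q a b c N + f₃ r q a b c N * F q N

/-- `μ(x) = q^{-2x} - (bc/a) q^{2x-4j}`. -/
noncomputable def mu (q a b c : ℂ) (N x : ℕ) : ℂ :=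
  q ^ (-2 * (x : ℤ)) - b * c / a * q ^ (2 * (x : ℤ) - 2 * N)

/-- The eigenvalue `λ_x = q^{2j} μ(x) / (q - q⁻¹)`. -/
noncomputable def eigval (q a b c : ℂ) (N x : ℕ) : ℂ :=
  q ^ N * mu q a b c N x / (q - q⁻¹)

/-- The normalized `q`-Racah components `p_n(x)`, in base `q²`. -/
noncomputable def p (q a b c : ℂ) (N x n : ℕ) : ℂ :=
  q ^ (N * n) / (q - q⁻¹) ^ n *
    (qPoch (b * q ^ (1 - (N : ℤ))) (q ^ 2) n * qPoch (c * q ^ (1 - (N : ℤ))) (q ^ 2) n *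
        qPoch (q ^ (-2 * (N : ℤ))) (q ^ 2) n /
      qPoch (-a * q ^ (2 * (n : ℤ) - 2 * N)) (q ^ 2) n) *
    qRacah n (mu q a b c N x) (b * q ^ (-(N : ℤ) - 1)) (-(a / b) * q ^ (-(N : ℤ) - 1))
      (q ^ (-2 - 2 * (N : ℤ))) (-(b * c / a)) (q ^ 2)

end UqSu2

/-! Put σ = q^N/(q - q⁻¹) with N = 2j. In the given basis 𝒴 is tridiagonal: E contributes 1's above
the diagonal, f₂ the diagonal, and f₃ F the entries below it. Row n of 𝒴 g = σX g therefore
determines g(n+1) from g(n) and g(n-1), so an eigenvector is fixed by g(0). The last row, where no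
g(N+1) exists, becomes a condition on X.

With Q = q², α = a/q^{2N}, β = bq/q^N, γ = cq/q^N and t = q^{-2N}, this recurrence is that of the
monic q-Racah polynomials P_n, up to the scaling g(n) = g(0) σ^n P_n(X). The recurrence
`monicRacah_rec` is proved in the Newton basis φ_k: X acts there by two terms, and neighbouring
coefficients of P_n have rational ratios, so everything reduces to the single identity
`coeff_identity`.

The condition from the last row is P_{N+1}(X) = 0. Since t Q^N = 1, P_{N+1} is a nonzero multiple of
φ_{N+1}, whose zeros are μ(0), …, μ(N). This gives both directions at once; no dimension count is
made, so the μ(x) need not be distinct. Finally `p_eq_racahPoly` identifies p_n(x) with σ^n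
P_n(μ(x)). -/

/-- The rational identity behind the three-term recurrence, with `u = Q ^ n` and `v = Q ^ k`. -/
theorem coeff_identity (α β γ t Q u v : ℂ) (hα : α ≠ 0) (hQ : Q ≠ 0) (hv : v ≠ 0)
    (h1 : u * Q - v ≠ 0) (h2 : Q + α * u * v ≠ 0) (h3 : 1 + α * u ^ 2 ≠ 0)
    (h4 : 1 + α * Q * u ^ 2 ≠ 0) (h5 : Q + α * u ^ 2 ≠ 0) :
    1 / v - β * γ * t * v / (α * Q) -
      (1 - v) * u * Q ^ 2 * ((1 - β * v / Q) * (1 - γ * v / Q) * (1 - t * v / Q)) /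
        (v * (u * Q - v) * (Q + α * u * v)) =
      (u * Q - 1) * ((1 - β * u) * (1 - γ * u) * (1 - t * u)) * (1 + α * u * v) /
          ((u * Q - v) * (1 + α * u ^ 2) * (1 + α * Q * u ^ 2)) +
      u * Q * (((t - α) * (α - β * γ / Q) / α + (β + γ) * (1 + t / Q)) * (1 - α * u ^ 2) +
        ((β + γ) * (α - t) * (1 + 1 / Q) + (α - β * γ / Q) * (1 + t / Q) * (1 + Q)) * u) /
          ((1 + α * Q * u ^ 2) * (Q + α * u ^ 2)) +
      (u - v) * ((α * u + Q) * (α * u + t) * (α * u + β) * (α * u + γ)) /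
          (α * (1 + α * u ^ 2) * (Q + α * u ^ 2) * (Q + α * u * v)) := by
  obtain ⟨d1, e1⟩ : ∃ d, d = u * Q - v := ⟨_, rfl⟩
  obtain ⟨d2, e2⟩ : ∃ d, d = Q + α * u * v := ⟨_, rfl⟩
  obtain ⟨d3, e3⟩ : ∃ d, d = 1 + α * u ^ 2 := ⟨_, rfl⟩
  obtain ⟨d4, e4⟩ : ∃ d, d = 1 + α * Q * u ^ 2 := ⟨_, rfl⟩
  obtain ⟨d5, e5⟩ : ∃ d, d = Q + α * u ^ 2 := ⟨_, rfl⟩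
  rw [← e1] at h1 ⊢
  rw [← e2] at h2 ⊢
  rw [← e3] at h3 ⊢
  rw [← e4] at h4 ⊢
  rw [← e5] at h5 ⊢
  field_simp
  subst e1 e2 e3 e4 e5
  ring

/-! ### Monic q-Racah polynomials in the Newton basis and their recurrence -/

/-- The cubic factor `(1 - β y)(1 - γ y)(1 - t y)`. -/
def cubicFactor (β γ t y : ℂ) : ℂ := (1 - β * y) * (1 - γ * y) * (1 - t * y)

/-- The Newton basis `φ_k(X) = ∏_{i < k} (1 - X Q^i + κ Q^{2i})` with `κ = -β γ t / (α Q)`. -/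
noncomputable def newtonBasis (α β γ t Q X : ℂ) (k : ℕ) : ℂ :=
  ∏ i ∈ Finset.range k, (1 - X * Q ^ i + -(β * γ * t / (α * Q)) * Q ^ (2 * i))

/-- The coefficient of `φ_k` in the monic `q`-Racah polynomial of degree `n`. -/
noncomputable def monicCoeff (α β γ t Q : ℂ) (n k : ℕ) : ℂ :=
  (∏ i ∈ Finset.range k, (1 - Q ^ i / Q ^ n)) * Q ^ k /
      (∏ i ∈ Finset.range k, (1 - Q ^ (i + 1))) *
    ((∏ i ∈ Finset.Ico k n, cubicFactor β γ t (Q ^ i)) /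
      ∏ i ∈ Finset.Ico k n, (1 + α * Q ^ (n + i)))

/-- The monic `q`-Racah polynomial of degree `n`. -/
noncomputable def monicRacah (α β γ t Q X : ℂ) (n : ℕ) : ℂ :=
  ∑ k ∈ Finset.range (n + 1), monicCoeff α β γ t Q n k * newtonBasis α β γ t Q X k

/-- The diagonal coefficient of the three-term recurrence, as a function of `u = Q ^ n`. -/
noncomputable def recDiag (α β γ t Q u : ℂ) : ℂ :=
  u * Q * (((t - α) * (α - β * γ / Q) / α + (β + γ) * (1 + t / Q)) * (1 - α * u ^ 2) +
        ((β + γ) * (α - t) * (1 + 1 / Q) + (α - β * γ / Q) * (1 + t / Q) * (1 + Q)) * u) /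
      ((1 + α * Q * u ^ 2) * (Q + α * u ^ 2))

/-- The lower coefficient of the three-term recurrence, as a function of `u = Q ^ n`. -/
noncomputable def recLower (α β γ t Q u : ℂ) : ℂ :=
  (u - 1) * cubicFactor β γ t (u / Q) *
      ((α * u + Q) * (α * u + t) * (α * u + β) * (α * u + γ)) * Q ^ 2 /
    (α * (1 + α * u ^ 2) * (Q + α * u ^ 2) ^ 2 * (Q ^ 2 + α * u ^ 2))

theorem monicCoeff_eq_zero (α β γ t Q : ℂ) (hQ : Q ≠ 0) {n k : ℕ} (h : n < k) :
    monicCoeff α β γ t Q n k = 0 := by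
  have : ∏ i ∈ Finset.range k, (1 - Q ^ i / Q ^ n) = 0 :=
    Finset.prod_eq_zero (Finset.mem_range.2 h) (by rw [div_self (pow_ne_zero _ hQ), sub_self])
  simp [monicCoeff, this]

/-- Both sides are the product over i ≤ k for n + 1: its factor at i = 0 is 1 - 1/Q^(n+1), and the
others are the factors for n shifted by one. -/
theorem prod_one_sub_div_succ (Q : ℂ) (hQ : Q ≠ 0) (n k : ℕ) :
    (∏ i ∈ Finset.range k, (1 - Q ^ i / Q ^ (n + 1))) * (1 - Q ^ k / Q ^ (n + 1)) =
      (∏ i ∈ Finset.range k, (1 - Q ^ i / Q ^ n)) * (1 - 1 / Q ^ (n + 1)) := by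
  rw [← Finset.prod_range_succ, Finset.prod_range_succ', pow_zero]
  congr 1
  refine Finset.prod_congr rfl fun i _ => ?_
  rw [pow_succ, pow_succ, mul_div_mul_right _ _ hQ]

/-- Both sides equal the product of d j over n + k ≤ j ≤ 2n + 1. -/
theorem prod_Ico_shift_two (d : ℕ → ℂ) {n k : ℕ} (h : k ≤ n) :
    (∏ i ∈ Finset.Ico k (n + 1), d (n + 1 + i)) * d (n + k) =
      (∏ i ∈ Finset.Ico k n, d (n + i)) * (d (2 * n) * d (2 * n + 1)) := by
  have e (a b : ℕ) : ∏ i ∈ Finset.Ico k a, d (b + i) =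
      ∏ j ∈ Finset.Ico (b + k) (b + a), d j := by
    rw [Finset.prod_Ico_add, add_comm k b, add_comm a b]
  rw [e, e, mul_comm, show n + 1 + k = n + k + 1 by ring,
    Finset.prod_eq_prod_Ico_succ_bot (show n + k < n + 1 + (n + 1) by omega) d |>.symm,
    show n + 1 + (n + 1) = n + n + 1 + 1 by ring, Finset.prod_Ico_succ_top (by omega),
    Finset.prod_Ico_succ_top (by omega), mul_assoc, two_mul]

/-- Together with the next lemma, this makes every coefficient in the recurrence a rational multiple
of one of them. -/
theorem monicCoeff_succ_left (α β γ t Q : ℂ) (hQ : Q ≠ 0) {n k : ℕ} (h : k ≤ n)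
    (hd : ∀ j, j ≤ 2 * n + 1 → 1 + α * Q ^ j ≠ 0) :
    monicCoeff α β γ t Q (n + 1) k *
        ((Q ^ n * Q - Q ^ k) * (1 + α * (Q ^ n) ^ 2) * (1 + α * Q * (Q ^ n) ^ 2)) =
      monicCoeff α β γ t Q n k *
        ((Q ^ n * Q - 1) * cubicFactor β γ t (Q ^ n) * (1 + α * Q ^ n * Q ^ k)) := by
  have h1 := prod_one_sub_div_succ Q hQ n k
  have h2 := prod_Ico_shift_two (fun j => 1 + α * Q ^ j) h
  have hD1 : ∏ i ∈ Finset.Ico k (n + 1), (1 + α * Q ^ (n + 1 + i)) ≠ 0 :=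
    Finset.prod_ne_zero_iff.2 fun i hi => hd _ (by have := Finset.mem_Ico.1 hi; omega)
  have hD : ∏ i ∈ Finset.Ico k n, (1 + α * Q ^ (n + i)) ≠ 0 :=
    Finset.prod_ne_zero_iff.2 fun i hi => hd _ (by have := Finset.mem_Ico.1 hi; omega)
  unfold monicCoeff
  rw [Finset.prod_Ico_succ_top h]
  beta_reduce at h2
  generalize ∏ i ∈ Finset.Ico k (n + 1), (1 + α * Q ^ (n + 1 + i)) = D1 at *
  generalize ∏ i ∈ Finset.Ico k n, (1 + α * Q ^ (n + i)) = D at *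
  generalize ∏ i ∈ Finset.range k, (1 - Q ^ i / Q ^ (n + 1)) = H1 at *
  generalize ∏ i ∈ Finset.range k, (1 - Q ^ i / Q ^ n) = H at *
  generalize ∏ i ∈ Finset.range k, (1 - Q ^ (i + 1)) = B at *
  generalize ∏ i ∈ Finset.Ico k n, cubicFactor β γ t (Q ^ i) = G at *
  generalize cubicFactor β γ t (Q ^ n) = g at *
  have h1' : H1 * (Q ^ n * Q - Q ^ k) = H * (Q ^ n * Q - 1) := by
    have : Q ^ (n + 1) ≠ 0 := pow_ne_zero _ hQ
    field_simp at h1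
    rw [← pow_succ]
    linear_combination h1
  have h2' : (1 + α * (Q ^ n) ^ 2) * (1 + α * Q * (Q ^ n) ^ 2) / D1 =
      (1 + α * Q ^ n * Q ^ k) / D := by
    rw [div_eq_div_iff hD1 hD]
    have e1 : Q ^ (2 * n) = (Q ^ n) ^ 2 := by rw [mul_comm, pow_mul]
    rw [pow_add, pow_succ, e1] at h2
    linear_combination -h2
  calc _ = (H1 * (Q ^ n * Q - Q ^ k)) * Q ^ k / B * (G * g) *
        ((1 + α * (Q ^ n) ^ 2) * (1 + α * Q * (Q ^ n) ^ 2) / D1) := by ring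
    _ = _ := by rw [h1', h2']; ring

/-- The cubic factor stays on the left as a multiplier because it may vanish; it does so when t Q^k
= 1, which is what causes truncation. -/
theorem monicCoeff_succ_right (α β γ t Q : ℂ) (hQ1 : ∀ m : ℕ, 1 ≤ m → Q ^ m ≠ 1)
    {n k : ℕ} (h : k < n) (hd : 1 + α * Q ^ (n + k) ≠ 0) :
    monicCoeff α β γ t Q n (k + 1) * ((1 - Q ^ (k + 1)) * cubicFactor β γ t (Q ^ k)) =
      monicCoeff α β γ t Q n k * ((1 - Q ^ k / Q ^ n) * Q * (1 + α * Q ^ (n + k))) := by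
  unfold monicCoeff
  have hk : 1 - Q ^ (k + 1) ≠ 0 := sub_ne_zero.2 (hQ1 _ (by omega)).symm
  rw [Finset.prod_range_succ, Finset.prod_range_succ, Finset.prod_eq_prod_Ico_succ_bot h,
    Finset.prod_eq_prod_Ico_succ_bot h]
  generalize ∏ i ∈ Finset.range k, (1 - Q ^ (i + 1)) = B at *
  generalize ∏ i ∈ Finset.Ico (k + 1) n, (1 + α * Q ^ (n + i)) = D at *
  rw [mul_div_mul_comm _ _ _ D, pow_succ Q k] at *
  generalize 1 - Q ^ k * Q = z at *
  generalize 1 + α * Q ^ (n + k) = y at *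
  rw [mul_comm B z, ← div_div]
  field_simp

/-- This is the top-degree comparison in the recurrence. It also shows by induction that the leading
coefficient never vanishes. -/
theorem monicCoeff_diag_succ (α β γ t Q : ℂ) (hQ : Q ≠ 0) (hQ1 : ∀ m : ℕ, 1 ≤ m → Q ^ m ≠ 1)
    (n : ℕ) :
    monicCoeff α β γ t Q (n + 1) (n + 1) * Q ^ n = -monicCoeff α β γ t Q n n := by
  unfold monicCoeff
  have hk : 1 - Q ^ (n + 1) ≠ 0 := sub_ne_zero.2 (hQ1 _ (by omega)).symm
  have hn : Q ^ (n + 1) ≠ 0 := pow_ne_zero _ hQ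
  rw [Finset.prod_range_succ, prod_one_sub_div_succ Q hQ, Finset.prod_range_succ]
  simp only [Finset.Ico_self, Finset.prod_empty, div_one, mul_one]
  have e : (1 - 1 / Q ^ (n + 1)) = -(1 - Q ^ (n + 1)) / Q ^ (n + 1) := by field_simp; ring
  rw [e]
  generalize ∏ i ∈ Finset.range n, (1 - Q ^ (i + 1)) = B at *
  generalize 1 - Q ^ (n + 1) = z at *
  rw [mul_comm B z, ← div_div]
  field_simp

theorem monicCoeff_diag_ne_zero (α β γ t Q : ℂ) (hQ : Q ≠ 0) (hQ1 : ∀ m : ℕ, 1 ≤ m → Q ^ m ≠ 1)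
    (n : ℕ) : monicCoeff α β γ t Q n n ≠ 0 := by
  induction n with
  | zero => simp [monicCoeff]
  | succ n ih =>
    intro h
    have := monicCoeff_diag_succ α β γ t Q hQ hQ1 n
    rw [h, zero_mul] at this
    exact ih (neg_eq_zero.1 this.symm)

/-- Q(1 + αQ^j) = Q + αQ^(j+1), so one family of hypotheses covers both kinds of denominator. -/
theorem one_add_mul_pow_ne_zero {α Q : ℂ} {M j : ℕ}
    (hd : ∀ j, j ≤ M → Q + α * Q ^ j ≠ 0) (hj : j + 1 ≤ M) : 1 + α * Q ^ j ≠ 0 := fun h =>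
  hd _ hj (by rw [pow_succ]; linear_combination Q * h)

theorem recLower_mul_monicCoeff (α β γ t Q : ℂ) (hα : α ≠ 0) (hQ : Q ≠ 0) {n k : ℕ} (h : k ≤ n)
    (hd : ∀ j, j ≤ 2 * n + 2 → Q + α * Q ^ j ≠ 0) :
    recLower α β γ t Q (Q ^ n) * monicCoeff α β γ t Q (n - 1) k =
      monicCoeff α β γ t Q n k *
        ((Q ^ n - Q ^ k) * ((α * Q ^ n + Q) * (α * Q ^ n + t) * (α * Q ^ n + β) * (α * Q ^ n + γ)) /
          (α * (1 + α * (Q ^ n) ^ 2) * (Q + α * (Q ^ n) ^ 2) * (Q + α * Q ^ n * Q ^ k))) := by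
  -- At n = 0 the factor u - 1 of `recLower` vanishes, so the truncated index n - 1 = 0 is harmless.
  -- At k = n both sides vanish: the left through the coefficient, the right through u - v.
  rcases n with _ | m
  · obtain rfl : k = 0 := by omega
    simp [recLower]
  rcases h.eq_or_lt with rfl | h
  · rw [monicCoeff_eq_zero _ _ _ _ _ hQ (by simp)]
    simp
  have hk : k ≤ m := by omega
  have key := monicCoeff_succ_left α β γ t Q hQ hk
    (fun j hj => one_add_mul_pow_ne_zero hd (by omega))
  have n1 := one_add_mul_pow_ne_zero hd (show m + k + 1 ≤ _ by omega)
  have n2 := one_add_mul_pow_ne_zero hd (show 2 * m + 1 ≤ _ by omega)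
  have n3 := one_add_mul_pow_ne_zero hd (show 2 * m + 1 + 1 ≤ _ by omega)
  have n4 := one_add_mul_pow_ne_zero hd (show 2 * (m + 1) + 1 ≤ _ by omega)
  have e1 : 1 + α * Q ^ (m + k) = 1 + α * Q ^ m * Q ^ k := by ring
  have e2 : 1 + α * Q ^ (2 * m) = 1 + α * (Q ^ m) ^ 2 := by ring
  have e3 : 1 + α * Q ^ (2 * m + 1) = 1 + α * Q * (Q ^ m) ^ 2 := by ring
  have e4 : 1 + α * Q ^ (2 * (m + 1)) = 1 + α * (Q ^ m * Q) ^ 2 := by ring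
  rw [e1] at n1
  rw [e2] at n2
  rw [e3] at n3
  rw [e4] at n4
  rw [Nat.add_sub_cancel, recLower, pow_succ, mul_div_cancel_right₀ _ hQ]
  generalize monicCoeff α β γ t Q (m + 1) k = A1 at *
  generalize monicCoeff α β γ t Q m k = A at *
  generalize cubicFactor β γ t (Q ^ m) = g at *
  generalize Q ^ m = y at *
  generalize Q ^ k = v at *
  have f1 : Q + α * (y * Q) * v = Q * (1 + α * y * v) := by ring
  have f2 : Q + α * (y * Q) ^ 2 = Q * (1 + α * Q * y ^ 2) := by ring
  have f3 : Q ^ 2 + α * (y * Q) ^ 2 = Q ^ 2 * (1 + α * y ^ 2) := by ring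
  rw [f1, f2, f3]
  generalize 1 + α * y * v = d1 at *
  generalize 1 + α * y ^ 2 = d2 at *
  generalize 1 + α * Q * y ^ 2 = d3 at *
  generalize 1 + α * (y * Q) ^ 2 = d4 at *
  generalize (α * (y * Q) + Q) * (α * (y * Q) + t) * (α * (y * Q) + β) * (α * (y * Q) + γ) = P at *
  have key' : A * ((y * Q - 1) * g) / (d2 * d3) = A1 * (y * Q - v) / d1 := by
    rw [div_eq_div_iff (mul_ne_zero n2 n3) n1]
    linear_combination -key
  calc _ = (A * ((y * Q - 1) * g) / (d2 * d3)) * (P / (α * d4 * (Q * d3))) / Q := by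
        field_simp
    _ = _ := by rw [key']; field_simp

theorem pred_monicCoeff_eq (α β γ t Q : ℂ) (hQ : Q ≠ 0) (hQ1 : ∀ m : ℕ, 1 ≤ m → Q ^ m ≠ 1)
    {n k : ℕ} (h : k < n) (hd : ∀ j, j ≤ 2 * n + 2 → Q + α * Q ^ j ≠ 0) :
    monicCoeff α β γ t Q n k / Q ^ k = monicCoeff α β γ t Q n (k + 1) *
      ((1 - Q ^ (k + 1)) * Q ^ n * Q ^ 2 * ((1 - β * Q ^ (k + 1) / Q) * (1 - γ * Q ^ (k + 1) / Q) *
        (1 - t * Q ^ (k + 1) / Q)) /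
        (Q ^ (k + 1) * (Q ^ n * Q - Q ^ (k + 1)) * (Q + α * Q ^ n * Q ^ (k + 1)))) := by
  have n1 := one_add_mul_pow_ne_zero hd (show n + k + 1 ≤ _ by omega)
  have key := monicCoeff_succ_right α β γ t Q hQ1 h n1
  have hk : Q ^ n - Q ^ k ≠ 0 := by
    obtain ⟨l, rfl⟩ := Nat.exists_eq_add_of_lt h
    have : Q ^ (k + l + 1) - Q ^ k = Q ^ k * (Q ^ (l + 1) - 1) := by ring
    rw [this]
    exact mul_ne_zero (pow_ne_zero _ hQ) (sub_ne_zero.2 (hQ1 _ (by omega)))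
  have e (z : ℂ) : z * Q ^ (k + 1) / Q = z * Q ^ k := by
    rw [pow_succ, ← mul_assoc, mul_div_cancel_right₀ _ hQ]
  simp only [e]
  rw [← cubicFactor.eq_1]
  have hn : Q ^ n ≠ 0 := pow_ne_zero _ hQ
  have hk' : Q ^ k ≠ 0 := pow_ne_zero _ hQ
  rw [pow_add] at n1
  rw [pow_add Q n] at key
  rw [pow_succ] at *
  generalize monicCoeff α β γ t Q n (k + 1) = A1 at *
  generalize monicCoeff α β γ t Q n k = A at *
  generalize cubicFactor β γ t (Q ^ k) = g at *
  generalize Q ^ n = u at *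
  generalize Q ^ k = v at *
  have f1 : Q + α * u * (v * Q) = Q * (1 + α * (u * v)) := by ring
  have f2 : u * Q - v * Q = Q * (u - v) := by ring
  have f3 : (1 - v / u) = (u - v) / u := by field_simp
  rw [f1, f2]
  rw [f3] at key
  generalize u - v = d2 at *
  generalize 1 + α * (u * v) = d1 at *
  generalize 1 - v * Q = d3 at *
  field_simp at key ⊢
  linear_combination -key

/-- This compares coefficients of φ_k for k ≤ n. The subtracted term is the contribution of φ_{k-1},
rewritten as a multiple of the k-th coefficient; at k = 0 it vanishes through 1 - Q^k. -/
theorem monicCoeff_rec_of_le (α β γ t Q : ℂ) (hα : α ≠ 0) (hQ : Q ≠ 0)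
    (hQ1 : ∀ m : ℕ, 1 ≤ m → Q ^ m ≠ 1) {n k : ℕ} (h : k ≤ n)
    (hd : ∀ j, j ≤ 2 * n + 2 → Q + α * Q ^ j ≠ 0) :
    (1 / Q ^ k - β * γ * t * Q ^ k / (α * Q)) * monicCoeff α β γ t Q n k -
        monicCoeff α β γ t Q n k *
          ((1 - Q ^ k) * Q ^ n * Q ^ 2 * ((1 - β * Q ^ k / Q) * (1 - γ * Q ^ k / Q) *
            (1 - t * Q ^ k / Q)) /
            (Q ^ k * (Q ^ n * Q - Q ^ k) * (Q + α * Q ^ n * Q ^ k))) =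
      monicCoeff α β γ t Q (n + 1) k +
        recDiag α β γ t Q (Q ^ n) * monicCoeff α β γ t Q n k +
        recLower α β γ t Q (Q ^ n) * monicCoeff α β γ t Q (n - 1) k := by
  have h1 : Q ^ n * Q - Q ^ k ≠ 0 := by
    obtain ⟨l, rfl⟩ := Nat.exists_eq_add_of_le h
    have : Q ^ (k + l) * Q - Q ^ k = Q ^ k * (Q ^ (l + 1) - 1) := by ring
    rw [this]
    exact mul_ne_zero (pow_ne_zero _ hQ) (sub_ne_zero.2 (hQ1 _ (by omega)))
  have h2 : Q + α * Q ^ n * Q ^ k ≠ 0 := by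
    have := hd (n + k) (by omega)
    rwa [pow_add, ← mul_assoc] at this
  have h3 : 1 + α * (Q ^ n) ^ 2 ≠ 0 := by
    have := one_add_mul_pow_ne_zero hd (show n * 2 + 1 ≤ _ by omega)
    rwa [pow_mul] at this
  have h4 : 1 + α * Q * (Q ^ n) ^ 2 ≠ 0 := by
    have := one_add_mul_pow_ne_zero hd (show n * 2 + 1 + 1 ≤ _ by omega)
    rwa [pow_succ, pow_mul, mul_comm _ Q, ← mul_assoc] at this
  have h5 : Q + α * (Q ^ n) ^ 2 ≠ 0 := by
    have := hd (n * 2) (by omega)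
    rwa [pow_mul] at this
  have key := coeff_identity α β γ t Q (Q ^ n) (Q ^ k) hα hQ (pow_ne_zero _ hQ) h1 h2 h3 h4 h5
  have up : monicCoeff α β γ t Q (n + 1) k = monicCoeff α β γ t Q n k *
      ((Q ^ n * Q - 1) * ((1 - β * Q ^ n) * (1 - γ * Q ^ n) * (1 - t * Q ^ n)) *
        (1 + α * Q ^ n * Q ^ k) /
      ((Q ^ n * Q - Q ^ k) * (1 + α * (Q ^ n) ^ 2) * (1 + α * Q * (Q ^ n) ^ 2))) := by
    rw [← mul_div_assoc, eq_div_iff (mul_ne_zero (mul_ne_zero h1 h3) h4)]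
    exact monicCoeff_succ_left α β γ t Q hQ h fun j hj => one_add_mul_pow_ne_zero hd (by omega)
  rw [recLower_mul_monicCoeff α β γ t Q hα hQ h hd, up, recDiag]
  linear_combination monicCoeff α β γ t Q n k * key

theorem monicRacah_eq_sum (α β γ t Q X : ℂ) (hQ : Q ≠ 0) {n M : ℕ} (h : n < M) :
    monicRacah α β γ t Q X n =
      ∑ k ∈ Finset.range M, monicCoeff α β γ t Q n k * newtonBasis α β γ t Q X k := by
  refine Finset.sum_subset (Finset.range_subset_range.2 h) fun k _ hk => ?_
  rw [monicCoeff_eq_zero _ _ _ _ _ hQ (by simpa using hk), zero_mul]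

/-- Solve φ_{k+1} = φ_k · (1 - XQ^k + κQ^{2k}) for X φ_k. -/
theorem mul_newtonBasis (α β γ t Q X : ℂ) (hQ : Q ≠ 0) (k : ℕ) :
    X * newtonBasis α β γ t Q X k =
      (1 / Q ^ k - β * γ * t * Q ^ k / (α * Q)) * newtonBasis α β γ t Q X k -
        newtonBasis α β γ t Q X (k + 1) / Q ^ k := by
  have hk : Q ^ k ≠ 0 := pow_ne_zero _ hQ
  rw [newtonBasis, newtonBasis, Finset.prod_range_succ, mul_comm 2 k, pow_mul]
  rw [mul_div_right_comm _ (Q ^ k)]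
  generalize β * γ * t / (α * Q) = κ
  field_simp
  ring

/-- The three-term recurrence of the monic `q`-Racah polynomials. -/
theorem monicRacah_rec (α β γ t Q X : ℂ) (hα : α ≠ 0) (hQ : Q ≠ 0)
    (hQ1 : ∀ m : ℕ, 1 ≤ m → Q ^ m ≠ 1) (n : ℕ)
    (hd : ∀ j, j ≤ 2 * n + 2 → Q + α * Q ^ j ≠ 0) :
    X * monicRacah α β γ t Q X n = monicRacah α β γ t Q X (n + 1) +
      recDiag α β γ t Q (Q ^ n) * monicRacah α β γ t Q X n +
      recLower α β γ t Q (Q ^ n) * monicRacah α β γ t Q X (n - 1) := by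
  have hL : X * monicRacah α β γ t Q X n =
      ∑ k ∈ Finset.range (n + 2), ((1 / Q ^ k - β * γ * t * Q ^ k / (α * Q)) *
        monicCoeff α β γ t Q n k) * newtonBasis α β γ t Q X k -
      ∑ k ∈ Finset.range (n + 1), (monicCoeff α β γ t Q n k / Q ^ k) *
        newtonBasis α β γ t Q X (k + 1) := by
    rw [Finset.sum_range_succ _ (n + 1), monicCoeff_eq_zero _ _ _ _ _ hQ (Nat.lt_succ_self n),
      mul_zero, zero_mul, add_zero, ← Finset.sum_sub_distrib, monicRacah, Finset.mul_sum]
    refine Finset.sum_congr rfl fun k _ => ?_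
    linear_combination monicCoeff α β γ t Q n k * mul_newtonBasis α β γ t Q X hQ k
  rw [hL, monicRacah_eq_sum α β γ t Q X hQ (show n < n + 2 by omega),
    monicRacah_eq_sum α β γ t Q X hQ (show n - 1 < n + 2 by omega),
    monicRacah_eq_sum α β γ t Q X hQ (show n + 1 < n + 2 by omega), Finset.mul_sum, Finset.mul_sum,
    ← Finset.sum_add_distrib, ← Finset.sum_add_distrib,
    Finset.sum_range_succ' _ (n + 1), Finset.sum_range_succ' _ (n + 1), add_sub_right_comm,
    ← Finset.sum_sub_distrib]
  congr 1
  · refine Finset.sum_congr rfl fun k hk => ?_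
    -- The index of φ is k + 1 here. For k = n only the leading coefficients survive; smaller k fall
    -- under the generic identity.
    rcases (Nat.lt_succ_iff.1 (Finset.mem_range.1 hk)).eq_or_lt with rfl | hk
    · have := monicCoeff_diag_succ α β γ t Q hQ hQ1 k
      have e : monicCoeff α β γ t Q k k / Q ^ k = -monicCoeff α β γ t Q (k + 1) (k + 1) := by
        rw [div_eq_iff (pow_ne_zero _ hQ)]
        linear_combination this
      rw [monicCoeff_eq_zero α β γ t Q hQ (Nat.lt_succ_self k),
        monicCoeff_eq_zero α β γ t Q hQ (show k - 1 < k + 1 by omega), e]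
      ring
    · have key := monicCoeff_rec_of_le α β γ t Q hα hQ hQ1 (show k + 1 ≤ n from hk) hd
      rw [← pred_monicCoeff_eq α β γ t Q hQ hQ1 hk hd] at key
      linear_combination newtonBasis α β γ t Q X (k + 1) * key
  · have key := monicCoeff_rec_of_le α β γ t Q hα hQ hQ1 (Nat.zero_le n) hd
    rw [pow_zero, sub_self] at key
    rw [pow_zero]
    linear_combination newtonBasis α β γ t Q X 0 * key

theorem monicRacah_zero (α β γ t Q X : ℂ) : monicRacah α β γ t Q X 0 = 1 := by
  simp [monicRacah, monicCoeff, newtonBasis]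

/-- Truncation: if `t Q ^ N = 1` then the polynomial of degree `N + 1` is a Newton product. -/
theorem monicRacah_truncation (α β γ t Q X : ℂ) (N : ℕ) (ht : t * Q ^ N = 1) :
    monicRacah α β γ t Q X (N + 1) =
      monicCoeff α β γ t Q (N + 1) (N + 1) * newtonBasis α β γ t Q X (N + 1) := by
  rw [monicRacah, Finset.sum_range_succ, Finset.sum_eq_zero, zero_add]
  intro k hk
  have : ∏ i ∈ Finset.Ico k (N + 1), cubicFactor β γ t (Q ^ i) = 0 :=
    Finset.prod_eq_zero (Finset.mem_Ico.2 ⟨by have := Finset.mem_range.1 hk; omega,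
      Nat.lt_succ_self N⟩) (by simp [cubicFactor, ht])
  simp [monicCoeff, this]

/-! ### Matching the entries of 𝒴 with the recurrence coefficients -/

/-- Here w = q^N, u = q^{2n} and s = q - q⁻¹; K² acts as w/u and C as wq + (wq)⁻¹, so the left side
is the n-th diagonal entry of f₂. -/
theorem recDiag_scalar (q a b c w u s : ℂ) (hq : q ≠ 0) (ha : a ≠ 0) (hw : w ≠ 0) (hu : u ≠ 0)
    (hs : s ≠ 0) (h1 : w ^ 2 + a * q ^ 2 * u ^ 2 ≠ 0) (h2 : q ^ 2 * w ^ 2 + a * u ^ 2 ≠ 0) :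
    w / u * (((1 - a) * (a - b * c) / a + (b + c) * (w * q + (w * q)⁻¹)) * ((w / u) ^ 2 - a) +
        ((b + c) * (a - 1) + (a - b * c) * (w * q + (w * q)⁻¹)) * ((q + q⁻¹) * (w / u))) *
      (s * ((q⁻¹ ^ 2 * (w / u) ^ 2 + a) * (q ^ 2 * (w / u) ^ 2 + a)))⁻¹ =
    w / s * recDiag (a / w ^ 2) (b * q / w) (c * q / w) (1 / w ^ 2) (q ^ 2) u := by
  have e1 : q⁻¹ ^ 2 * (w / u) ^ 2 + a = (w ^ 2 + a * q ^ 2 * u ^ 2) / (q ^ 2 * u ^ 2) := by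
    field_simp
  have e2 : q ^ 2 * (w / u) ^ 2 + a = (q ^ 2 * w ^ 2 + a * u ^ 2) / u ^ 2 := by
    field_simp
  have e3 : 1 + a / w ^ 2 * q ^ 2 * u ^ 2 = (w ^ 2 + a * q ^ 2 * u ^ 2) / w ^ 2 := by
    field_simp
  have e4 : q ^ 2 + a / w ^ 2 * u ^ 2 = (q ^ 2 * w ^ 2 + a * u ^ 2) / w ^ 2 := by
    field_simp
  rw [recDiag, e1, e2, e3, e4]
  generalize w ^ 2 + a * q ^ 2 * u ^ 2 = d1 at *
  generalize q ^ 2 * w ^ 2 + a * u ^ 2 = d2 at *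
  clear e1 e2 e3 e4
  field_simp
  ring

/-- Here y = q^n, since the q-numbers of F contain odd powers of it. The factor with C splits as (a
+ q²w²/u)(a + 1/u) for u = y², giving αu + Q and αu + t; the two q-numbers give 1 - tu/Q and u - 1.
-/
theorem recLower_scalar (q a b c w y s : ℂ) (hq : q ≠ 0) (ha : a ≠ 0) (hw : w ≠ 0) (hy : y ≠ 0)
    (hs : s ≠ 0) (h1 : w ^ 2 + a * (y ^ 2) ^ 2 ≠ 0) (h2 : q ^ 2 * w ^ 2 + a * (y ^ 2) ^ 2 ≠ 0)
    (h3 : q ^ 4 * w ^ 2 + a * (y ^ 2) ^ 2 ≠ 0) :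
    q * (w / y ^ 2) * ((a ^ 2 + a * q * ((w * q + (w * q)⁻¹) * (w / y ^ 2)) + q ^ 2 * (w / y ^ 2) ^ 2) *
        (b * q * (w / y ^ 2) + a) * (q * (w / y ^ 2) - b) * (q * (w / y ^ 2) - c) *
          (q * c * (w / y ^ 2) + a)) *
      (a * (((w / y ^ 2) ^ 2 + a) * (q ^ 2 * (w / y ^ 2) ^ 2 + a) ^ 2 *
        (q ^ 4 * (w / y ^ 2) ^ 2 + a)))⁻¹ *
      ((w * q / y - y / (w * q)) / s * ((y - 1 / y) / s)) =
    (w / s) ^ 2 *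
      recLower (a / w ^ 2) (b * q / w) (c * q / w) (1 / w ^ 2) (q ^ 2) (y ^ 2) := by
  have e1 : (w / y ^ 2) ^ 2 + a = (w ^ 2 + a * (y ^ 2) ^ 2) / y ^ 4 := by
    field_simp
  have e2 : q ^ 2 * (w / y ^ 2) ^ 2 + a = (q ^ 2 * w ^ 2 + a * (y ^ 2) ^ 2) / y ^ 4 := by
    field_simp
  have e3 : q ^ 4 * (w / y ^ 2) ^ 2 + a = (q ^ 4 * w ^ 2 + a * (y ^ 2) ^ 2) / y ^ 4 := by
    field_simp
  have e4 : 1 + a / w ^ 2 * (y ^ 2) ^ 2 = (w ^ 2 + a * (y ^ 2) ^ 2) / w ^ 2 := by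
    field_simp
  have e5 : q ^ 2 + a / w ^ 2 * (y ^ 2) ^ 2 = (q ^ 2 * w ^ 2 + a * (y ^ 2) ^ 2) / w ^ 2 := by
    field_simp
  have e6 : (q ^ 2) ^ 2 + a / w ^ 2 * (y ^ 2) ^ 2 =
      (q ^ 4 * w ^ 2 + a * (y ^ 2) ^ 2) / w ^ 2 := by
    field_simp
  rw [recLower, cubicFactor, e1, e2, e3, e4, e5, e6]
  generalize w ^ 2 + a * (y ^ 2) ^ 2 = d1 at *
  generalize q ^ 2 * w ^ 2 + a * (y ^ 2) ^ 2 = d2 at *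
  generalize q ^ 4 * w ^ 2 + a * (y ^ 2) ^ 2 = d3 at *
  clear e1 e2 e3 e4 e5 e6
  field_simp
  ring

theorem Matrix.inv_diagonal_of_ne_zero {n : Type*} [Fintype n] [DecidableEq n] (d : n → ℂ)
    (hd : ∀ i, d i ≠ 0) : (Matrix.diagonal d)⁻¹ = Matrix.diagonal fun i => (d i)⁻¹ := by
  refine Matrix.inv_eq_right_inv ?_
  rw [Matrix.diagonal_mul_diagonal, ← Matrix.diagonal_one]
  congr 1
  funext i
  exact mul_inv_cancel₀ (hd i)

/-! ### The operators of the representation as explicit matrices -/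

namespace UqSu2

/-- f₂ and f₃ involve K outside the Casimir only through K² and K⁴, so r drops out in favour of q.
-/
theorem K_sq (r q : ℂ) (N : ℕ) (hr : r ^ 2 = q) (hq : q ≠ 0) :
    K r N ^ 2 = Matrix.diagonal fun n : Fin (N + 1) => q ^ N / (q ^ 2) ^ (n : ℕ) := by
  rw [K, Matrix.diagonal_pow]
  congr 1
  funext n
  have hr0 : r ≠ 0 := by rintro rfl; simp at hr; exact hq hr.symm
  simp only [Pi.pow_apply]
  rw [← hr, zpow_sub₀ hr0, zpow_natCast, zpow_mul, zpow_natCast, div_pow]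
  congr 1
  · ring
  · norm_cast
    ring

theorem E_mul_F (q : ℂ) (N : ℕ) : E N * F q N =
    Matrix.diagonal fun n : Fin (N + 1) => qNum q ((N : ℤ) - (n : ℕ)) * qNum q ((n : ℕ) + 1) := by
  ext i j
  rw [Matrix.mul_apply]
  simp only [E, F, Matrix.of_apply, Matrix.diagonal_apply]
  by_cases hi : (i : ℕ) < N
  · rw [Finset.sum_eq_single (⟨i + 1, by omega⟩ : Fin (N + 1))]
    · by_cases hij : i = j
      · subst hij; simp
      · have : (i : ℕ) ≠ j := fun h => hij (Fin.ext h)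
        simp [hij, this]
    · intro l _ hl
      rw [if_neg, zero_mul]
      intro h
      exact hl (Fin.ext h.symm)
    · simp
  -- In the last row E vanishes, in agreement with [N - N]_q = 0.
  · have hiN : (i : ℕ) = N := by omega
    rw [Finset.sum_eq_zero]
    · split_ifs with hij
      · simp [hiN, qNum]
      · rfl
    · intro l _
      rw [if_neg (by omega), zero_mul]

theorem casimir_eq (r q : ℂ) (N : ℕ) (hr : r ^ 2 = q) (hq : q ≠ 0) (hs : q - q⁻¹ ≠ 0) :
    casimir r q N = Matrix.diagonal fun _ => q ^ N * q + (q ^ N * q)⁻¹ := by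
  have hr0 : r ≠ 0 := by rintro rfl; simp at hr; exact hq hr.symm
  rw [casimir, E_mul_F, K, Matrix.inv_diagonal_of_ne_zero _ fun i => zpow_ne_zero _ hr0]
  simp only [← Matrix.diagonal_smul, Matrix.diagonal_sub, Matrix.diagonal_mul_diagonal,
    Matrix.diagonal_add, ← Matrix.diagonal_one]
  congr 1
  funext n
  simp only [Pi.smul_apply, smul_eq_mul, qNum]
  have e : r ^ ((N : ℤ) - 2 * (n : ℕ)) * r ^ ((N : ℤ) - 2 * (n : ℕ)) = q ^ N / (q ^ (n : ℕ)) ^ 2 := by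
    rw [zpow_sub₀ hr0, zpow_natCast, zpow_mul, ← hr]
    norm_cast
    field_simp
    exact pow_right_comm r N 2
  have hk : r ^ ((N : ℤ) - 2 * (n : ℕ)) ≠ 0 := zpow_ne_zero _ hr0
  generalize r ^ ((N : ℤ) - 2 * (n : ℕ)) = k at *
  rw [neg_sub, neg_add, zpow_sub₀ hq, zpow_sub₀ hq, zpow_add₀ hq, zpow_add₀ hq, zpow_neg, zpow_neg]
  simp only [zpow_natCast, zpow_one]
  have hw : q ^ N ≠ 0 := pow_ne_zero _ hq
  have hy : q ^ (n : ℕ) ≠ 0 := pow_ne_zero _ hq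
  generalize q ^ (n : ℕ) = y at *
  generalize q ^ N = w at *
  have e' : k⁻¹ * k⁻¹ = y ^ 2 / w := by
    rw [← mul_inv, e, inv_div]
  have hs2 : (q - q⁻¹) ^ 2 * ((w / y - y / w) / (q - q⁻¹) * ((y * q - y⁻¹ * q⁻¹) / (q - q⁻¹)) +
      (q - q⁻¹)⁻¹ * (k - k⁻¹) * ((q - q⁻¹)⁻¹ * (q⁻¹ * k - q * k⁻¹))) =
      (w / y - y / w) * (y * q - y⁻¹ * q⁻¹) + (k - k⁻¹) * (q⁻¹ * k - q * k⁻¹) := by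
    generalize q - q⁻¹ = s at *
    field_simp
  have hk2 : (k - k⁻¹) * (q⁻¹ * k - q * k⁻¹) =
      q⁻¹ * (w / y ^ 2) + q * (y ^ 2 / w) - (q + q⁻¹) := by
    linear_combination q⁻¹ * e + q * e' - (q + q⁻¹) * mul_inv_cancel₀ hk
  rw [hs2, hk2]
  field_simp
  ring

theorem f₂_eq (r q a b c : ℂ) (N : ℕ) (hr : r ^ 2 = q) (hq : q ≠ 0) (hs : q - q⁻¹ ≠ 0) (ha : a ≠ 0)
    (h1 : ∀ n ≤ N, (q ^ N) ^ 2 + a * q ^ 2 * ((q ^ 2) ^ n) ^ 2 ≠ 0)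
    (h2 : ∀ n ≤ N, q ^ 2 * (q ^ N) ^ 2 + a * ((q ^ 2) ^ n) ^ 2 ≠ 0) :
    f₂ r q a b c N = Matrix.diagonal fun n : Fin (N + 1) => q ^ N / (q - q⁻¹) *
      recDiag (a / (q ^ N) ^ 2) (b * q / q ^ N) (c * q / q ^ N) (1 / (q ^ N) ^ 2) (q ^ 2)
        ((q ^ 2) ^ (n : ℕ)) := by
  have hw : q ^ N ≠ 0 := pow_ne_zero _ hq
  simp only [f₂]
  rw [casimir_eq r q N hr hq hs, show K r N ^ 4 = (K r N ^ 2) ^ 2 by rw [← pow_mul],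
    K_sq r q N hr hq]
  simp only [← Matrix.diagonal_one, ← Matrix.diagonal_smul, Matrix.diagonal_sub,
    Matrix.diagonal_mul_diagonal, Matrix.diagonal_add, Matrix.diagonal_pow]
  rw [Matrix.inv_diagonal_of_ne_zero, Matrix.diagonal_mul_diagonal]
  · congr 1
    funext n
    simp only [Pi.smul_apply, Pi.pow_apply, smul_eq_mul, mul_one]
    exact recDiag_scalar q a b c (q ^ N) _ (q - q⁻¹) hq ha hw
      (pow_ne_zero _ (pow_ne_zero _ hq)) hs (h1 n (by omega)) (h2 n (by omega))
  · intro n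
    simp only [Pi.smul_apply, Pi.pow_apply, smul_eq_mul, mul_one]
    have hu : (q ^ 2) ^ (n : ℕ) ≠ 0 := pow_ne_zero _ (pow_ne_zero _ hq)
    have g1 := h1 n (by omega)
    have g2 := h2 n (by omega)
    generalize (q ^ 2) ^ (n : ℕ) = u at *
    generalize q ^ N = w at *
    refine mul_ne_zero hs (mul_ne_zero ?_ ?_)
    · rw [show q⁻¹ ^ 2 * (w / u) ^ 2 + a = (w ^ 2 + a * q ^ 2 * u ^ 2) / (q ^ 2 * u ^ 2) by
        field_simp]
      positivity
    · rw [show q ^ 2 * (w / u) ^ 2 + a = (q ^ 2 * w ^ 2 + a * u ^ 2) / u ^ 2 by field_simp]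
      positivity

/-- The diagonal recurrence coefficient in the parameters of the representation. -/
noncomputable def diagCoeff (q a b c : ℂ) (N n : ℕ) : ℂ :=
  recDiag (a / (q ^ N) ^ 2) (b * q / q ^ N) (c * q / q ^ N) (1 / (q ^ N) ^ 2) (q ^ 2) ((q ^ 2) ^ n)

/-- The lower recurrence coefficient in the parameters of the representation. -/
noncomputable def lowerCoeff (q a b c : ℂ) (N n : ℕ) : ℂ :=
  recLower (a / (q ^ N) ^ 2) (b * q / q ^ N) (c * q / q ^ N) (1 / (q ^ N) ^ 2) (q ^ 2)
    ((q ^ 2) ^ n)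

/-- The monic `q`-Racah polynomial in the parameters of the representation. -/
noncomputable def racahPoly (q a b c : ℂ) (N : ℕ) (X : ℂ) (n : ℕ) : ℂ :=
  monicRacah (a / (q ^ N) ^ 2) (b * q / q ^ N) (c * q / q ^ N) (1 / (q ^ N) ^ 2) (q ^ 2) X n

theorem f₃_mul_F (r q a b c : ℂ) (N : ℕ) (hr : r ^ 2 = q) (hq : q ≠ 0) (hs : q - q⁻¹ ≠ 0)
    (ha : a ≠ 0)
    (h1 : ∀ n ≤ N, (q ^ N) ^ 2 + a * ((q ^ 2) ^ n) ^ 2 ≠ 0)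
    (h2 : ∀ n ≤ N, q ^ 2 * (q ^ N) ^ 2 + a * ((q ^ 2) ^ n) ^ 2 ≠ 0)
    (h3 : ∀ n ≤ N, q ^ 4 * (q ^ N) ^ 2 + a * ((q ^ 2) ^ n) ^ 2 ≠ 0) :
    f₃ r q a b c N * F q N = Matrix.of fun m n : Fin (N + 1) =>
      if (m : ℕ) = n + 1 then (q ^ N / (q - q⁻¹)) ^ 2 * lowerCoeff q a b c N m else 0 := by
  have hw : q ^ N ≠ 0 := pow_ne_zero _ hq
  simp only [f₃]
  rw [casimir_eq r q N hr hq hs, show K r N ^ 4 = (K r N ^ 2) ^ 2 by rw [← pow_mul],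
    K_sq r q N hr hq]
  simp only [← Matrix.diagonal_one, ← Matrix.diagonal_smul, Matrix.diagonal_sub,
    Matrix.diagonal_mul_diagonal, Matrix.diagonal_add, Matrix.diagonal_pow]
  rw [Matrix.inv_diagonal_of_ne_zero, Matrix.diagonal_mul_diagonal]
  · ext m n
    rw [Matrix.diagonal_mul]
    simp only [Pi.smul_apply, Pi.pow_apply, smul_eq_mul, mul_one, F, Matrix.of_apply]
    split_ifs with hmn
    · rw [lowerCoeff, pow_right_comm q 2 (m : ℕ), ← recLower_scalar q a b c (q ^ N) (q ^ (m : ℕ))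
        (q - q⁻¹) hq ha hw (pow_ne_zero _ hq) hs
        (by rw [pow_right_comm q (m : ℕ) 2]; exact h1 m (by omega))
        (by rw [pow_right_comm q (m : ℕ) 2]; exact h2 m (by omega))
        (by rw [pow_right_comm q (m : ℕ) 2]; exact h3 m (by omega))]
      congr 1
      have e1 : (N : ℤ) - (n : ℕ) = N + 1 - (m : ℕ) := by rw [hmn]; push_cast; ring
      have e2 : ((n : ℕ) : ℤ) + 1 = (m : ℕ) := by rw [hmn]; push_cast; ring
      rw [e1, e2, qNum, qNum, neg_sub, zpow_sub₀ hq, zpow_sub₀ hq, zpow_neg, zpow_add₀ hq]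
      simp only [zpow_natCast, zpow_one, one_div]
    · rw [mul_zero]
  · intro n
    simp only [Pi.smul_apply, Pi.pow_apply, smul_eq_mul, mul_one]
    have hu : (q ^ 2) ^ (n : ℕ) ≠ 0 := pow_ne_zero _ (pow_ne_zero _ hq)
    have g1 := h1 n (by omega)
    have g2 := h2 n (by omega)
    have g3 := h3 n (by omega)
    generalize (q ^ 2) ^ (n : ℕ) = u at *
    generalize q ^ N = w at *
    refine mul_ne_zero ha (mul_ne_zero (mul_ne_zero ?_ (pow_ne_zero 2 ?_)) ?_)
    · rw [show (w / u) ^ 2 + a = (w ^ 2 + a * u ^ 2) / u ^ 2 by field_simp]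
      positivity
    · rw [show q ^ 2 * (w / u) ^ 2 + a = (q ^ 2 * w ^ 2 + a * u ^ 2) / u ^ 2 by field_simp]
      positivity
    · rw [show q ^ 4 * (w / u) ^ 2 + a = (q ^ 4 * w ^ 2 + a * u ^ 2) / u ^ 2 by field_simp]
      positivity

theorem lowerCoeff_zero (q a b c : ℂ) (N : ℕ) : lowerCoeff q a b c N 0 = 0 := by
  simp [lowerCoeff, recLower]

/-- The expression is q^{2j}(q^{2m} + a) with m = N + i - j; the bounds on i and j keep m in the
permitted range. -/
theorem add_mul_pow_ne_zero {N : ℕ} {q a : ℂ} (hq0 : q ≠ 0)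
    (hden : ∀ m : ℤ, -((N : ℤ) + 1) ≤ m → m ≤ (N : ℤ) + 2 → q ^ (2 * m) + a ≠ 0)
    {i j : ℕ} (h1 : i ≤ j + 2) (h2 : j ≤ 2 * N + i + 1) :
    q ^ (2 * i) * (q ^ N) ^ 2 + a * q ^ (2 * j) ≠ 0 := by
  have h := hden ((N : ℤ) + i - j) (by omega) (by omega)
  have e : q ^ (2 * i) * (q ^ N) ^ 2 + a * q ^ (2 * j) =
      q ^ (2 * j) * (q ^ (2 * ((N : ℤ) + i - j)) + a) := by
    rw [mul_add, mul_comm a, add_left_inj]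
    have : 2 * ((N : ℤ) + i - j) = (N * 2 : ℕ) + (2 * i : ℕ) - (2 * j : ℕ) := by
      push_cast; ring
    rw [this, zpow_sub₀ hq0, zpow_add₀ hq0, zpow_natCast, zpow_natCast, zpow_natCast,
      mul_div_cancel₀ _ (pow_ne_zero _ hq0), ← pow_mul, mul_comm]
  rw [e]
  exact mul_ne_zero (pow_ne_zero _ hq0) h

/-- Vectors are restrictions of functions on ℕ so that g(n ± 1) always makes sense; at n = 0 the
spurious g(0 - 1) is multiplied by a zero coefficient. -/
theorem Y_mulVec (r q a b c : ℂ) (N : ℕ) (hr : r ^ 2 = q) (hq : q ≠ 0) (hs : q - q⁻¹ ≠ 0)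
    (ha : a ≠ 0)
    (hden : ∀ m : ℤ, -((N : ℤ) + 1) ≤ m → m ≤ (N : ℤ) + 2 → q ^ (2 * m) + a ≠ 0)
    (g : ℕ → ℂ) (n : Fin (N + 1)) :
    (Y r q a b c N *ᵥ fun i : Fin (N + 1) => g i) n =
      (if (n : ℕ) < N then g (n + 1) else 0) +
        q ^ N / (q - q⁻¹) * diagCoeff q a b c N n * g n +
        (q ^ N / (q - q⁻¹)) ^ 2 * lowerCoeff q a b c N n * g (n - 1) := by
  have e (n : ℕ) : ((q ^ 2) ^ n) ^ 2 = q ^ (2 * (2 * n)) := by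
    rw [← pow_mul, ← pow_mul]; congr 1; ring
  rw [Y, f₂_eq r q a b c N hr hq hs ha, f₃_mul_F r q a b c N hr hq hs ha, Matrix.add_mulVec,
    Matrix.add_mulVec]
  · simp only [Pi.add_apply, Matrix.mulVec_diagonal]
    congr 1
    · congr 1
      rw [Matrix.mulVec, dotProduct]
      simp only [E, Matrix.of_apply]
      split_ifs with hn
      · rw [Finset.sum_eq_single (⟨n + 1, by omega⟩ : Fin (N + 1))]
        · simp
        · intro l _ hl
          rw [if_neg, zero_mul]
          exact fun h => hl (Fin.ext h.symm)
        · simp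
      · refine Finset.sum_eq_zero fun l _ => ?_
        rw [if_neg (by omega), zero_mul]
    · rw [Matrix.mulVec, dotProduct]
      simp only [Matrix.of_apply]
      rcases Nat.eq_zero_or_pos (n : ℕ) with hn | hn
      · rw [hn, lowerCoeff_zero, mul_zero, zero_mul]
        refine Finset.sum_eq_zero fun l _ => ?_
        rw [if_neg (by omega), zero_mul]
      · rw [Finset.sum_eq_single (⟨n - 1, by omega⟩ : Fin (N + 1))]
        · rw [if_pos (by simp only; omega)]
        · intro l _ hl
          rw [if_neg, zero_mul]
          intro h
          exact hl (Fin.ext (by simp only; omega))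
        · simp
  · intro n hn
    rw [e]
    simpa using add_mul_pow_ne_zero hq hden (i := 0) (j := 2 * n) (by omega) (by omega)
  · intro n hn
    rw [e]
    simpa using add_mul_pow_ne_zero hq hden (i := 1) (j := 2 * n) (by omega) (by omega)
  · intro n hn
    rw [e]
    simpa using add_mul_pow_ne_zero hq hden (i := 2) (j := 2 * n) (by omega) (by omega)
  · intro n hn
    rw [e, mul_assoc, ← pow_add]
    simpa [mul_add, add_comm] using
      add_mul_pow_ne_zero hq hden (i := 0) (j := 2 * n + 1) (by omega) (by omega)
  · intro n hn
    rw [e]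
    simpa using add_mul_pow_ne_zero hq hden (i := 1) (j := 2 * n) (by omega) (by omega)

/-! ### Recurrence and truncation in the representation's parameters -/

theorem sq_add_mul_pow_ne_zero {N : ℕ} {q a : ℂ} (hq0 : q ≠ 0)
    (hden : ∀ m : ℤ, -((N : ℤ) + 1) ≤ m → m ≤ (N : ℤ) + 2 → q ^ (2 * m) + a ≠ 0)
    {j : ℕ} (hj : j ≤ 2 * N + 2) : q ^ 2 + a / (q ^ N) ^ 2 * (q ^ 2) ^ j ≠ 0 := by
  have h := add_mul_pow_ne_zero hq0 hden (i := 1) (j := j) (by omega) (by omega)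
  have hw : (q ^ N) ^ 2 ≠ 0 := pow_ne_zero _ (pow_ne_zero _ hq0)
  intro h0
  rw [pow_mul q 2 j, mul_one] at h
  generalize (q ^ N) ^ 2 = w at *
  field_simp at h0
  exact h (by linear_combination h0)

theorem racahPoly_rec (q a b c X : ℂ) (N : ℕ) (hq0 : q ≠ 0) (ha : a ≠ 0)
    (hq : ∀ n : ℕ, 1 ≤ n → q ^ n ≠ 1)
    (hden : ∀ m : ℤ, -((N : ℤ) + 1) ≤ m → m ≤ (N : ℤ) + 2 → q ^ (2 * m) + a ≠ 0)
    {n : ℕ} (hn : n ≤ N) :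
    X * racahPoly q a b c N X n = racahPoly q a b c N X (n + 1) +
      diagCoeff q a b c N n * racahPoly q a b c N X n +
      lowerCoeff q a b c N n * racahPoly q a b c N X (n - 1) := by
  refine monicRacah_rec _ _ _ _ _ X (div_ne_zero ha (pow_ne_zero _ (pow_ne_zero _ hq0)))
    (pow_ne_zero _ hq0) (fun m hm => ?_) n fun j hj => sq_add_mul_pow_ne_zero hq0 hden (by omega)
  rw [← pow_mul]
  exact hq _ (by omega)

/-- The i-th Newton factor vanishes exactly at μ(i), which is where the spectrum comes from. -/
theorem newton_factor (q a b c X : ℂ) (N i : ℕ) (hq0 : q ≠ 0) (ha : a ≠ 0) :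
    1 - X * (q ^ 2) ^ i + -(b * q / q ^ N * (c * q / q ^ N) * (1 / (q ^ N) ^ 2) /
        (a / (q ^ N) ^ 2 * q ^ 2)) * (q ^ 2) ^ (2 * i) =
      (mu q a b c N i - X) * (q ^ 2) ^ i := by
  have hw : q ^ N ≠ 0 := pow_ne_zero _ hq0
  have hu : q ^ i ≠ 0 := pow_ne_zero _ hq0
  rw [mu, zpow_sub₀ hq0, neg_mul (2 : ℤ), zpow_neg, show 2 * (i : ℤ) = ((i * 2 : ℕ) : ℤ) by push_cast; ring,
    show 2 * (N : ℤ) = ((N * 2 : ℕ) : ℤ) by push_cast; ring, zpow_natCast, zpow_natCast,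
    pow_mul q i, pow_mul q N, mul_comm 2 i, pow_mul _ i 2, pow_right_comm q 2 i]
  field_simp
  ring

theorem racahPoly_top_eq_zero_iff (q a b c X : ℂ) (N : ℕ) (hq0 : q ≠ 0) (ha : a ≠ 0)
    (hq : ∀ n : ℕ, 1 ≤ n → q ^ n ≠ 1) :
    racahPoly q a b c N X (N + 1) = 0 ↔ ∃ x ≤ N, X = mu q a b c N x := by
  have hw : (q ^ N) ^ 2 ≠ 0 := pow_ne_zero _ (pow_ne_zero _ hq0)
  rw [racahPoly, monicRacah_truncation _ _ _ _ _ _ N (by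
    rw [pow_right_comm q 2 N, one_div, inv_mul_cancel₀ hw]), mul_eq_zero,
    or_iff_right (monicCoeff_diag_ne_zero _ _ _ _ _ (pow_ne_zero 2 hq0) (fun m hm => by
      rw [← pow_mul]; exact hq _ (by omega)) _), newtonBasis, Finset.prod_eq_zero_iff]
  refine exists_congr fun x => ?_
  rw [newton_factor _ _ _ _ _ _ _ hq0 ha, mul_eq_zero,
    or_iff_left (pow_ne_zero _ (pow_ne_zero _ hq0)), Finset.mem_range, Nat.lt_succ_iff, sub_eq_zero,
    eq_comm (a := X)]

end UqSu2

/-! ### Comparison with the standard normalization of R_n -/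

theorem qPoch_ne_zero {z Q : ℂ} {N k : ℕ} (h : ∀ i < N, z * Q ^ i ≠ 1) (hk : k ≤ N) :
    qPoch z Q k ≠ 0 :=
  Finset.prod_ne_zero_iff.2 fun i hi =>
    sub_ne_zero.2 (h i (by have := Finset.mem_range.1 hi; omega)).symm

theorem qPoch_eq_mul_prod_Ico (z Q : ℂ) {k n : ℕ} (h : k ≤ n) :
    qPoch z Q n = qPoch z Q k * ∏ i ∈ Finset.Ico k n, (1 - z * Q ^ i) :=
  (Finset.prod_range_mul_prod_Ico _ h).symm

/-- The monic `q`-Racah polynomial as a rescaled `q`-Racah polynomial. -/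
theorem monicRacah_eq_qRacah (α β γ t Q X A B Γ Δ : ℂ) (n : ℕ) (hβ : A * Q = β)
    (hγ : B * Δ * Q = γ) (ht : Γ * Q = t) (hAB : A * B * Q ^ (n + 1) = -(α * Q ^ n))
    (hκ : ∀ i : ℕ, Γ * Δ * Q ^ (2 * i + 1) = -(β * γ * t / (α * Q)) * Q ^ (2 * i))
    (h1 : ∀ i < n, β * Q ^ i ≠ 1) (h2 : ∀ i < n, γ * Q ^ i ≠ 1) (h3 : ∀ i < n, t * Q ^ i ≠ 1)
    (h4 : ∀ i < n, -(α * Q ^ n) * Q ^ i ≠ 1) :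
    qPoch β Q n * qPoch γ Q n * qPoch t Q n / qPoch (-(α * Q ^ n)) Q n *
      qRacah n X A B Γ Δ Q = monicRacah α β γ t Q X n := by
  rw [qRacah, monicRacah, Finset.mul_sum]
  refine Finset.sum_congr rfl fun k hk => ?_
  have hk : k ≤ n := Nat.lt_succ_iff.1 (Finset.mem_range.1 hk)
  have e1 : ∏ i ∈ Finset.range k, (1 - X * Q ^ i + Γ * Δ * Q ^ (2 * i + 1)) =
      newtonBasis α β γ t Q X k := Finset.prod_congr rfl fun i _ => by rw [hκ]
  have e2 : qPoch (Q ^ (-(n : ℤ))) Q k = ∏ i ∈ Finset.range k, (1 - Q ^ i / Q ^ n) :=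
    Finset.prod_congr rfl fun i _ => by rw [zpow_neg, zpow_natCast, div_eq_mul_inv, mul_comm]
  have e3 : qPoch Q Q k = ∏ i ∈ Finset.range k, (1 - Q ^ (i + 1)) :=
    Finset.prod_congr rfl fun i _ => by rw [pow_succ']
  have e4 : ∏ i ∈ Finset.Ico k n, cubicFactor β γ t (Q ^ i) =
      (∏ i ∈ Finset.Ico k n, (1 - β * Q ^ i)) * (∏ i ∈ Finset.Ico k n, (1 - γ * Q ^ i)) *
        ∏ i ∈ Finset.Ico k n, (1 - t * Q ^ i) := by
    rw [← Finset.prod_mul_distrib, ← Finset.prod_mul_distrib]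
    rfl
  have e5 : ∏ i ∈ Finset.Ico k n, (1 + α * Q ^ (n + i)) =
      ∏ i ∈ Finset.Ico k n, (1 - -(α * Q ^ n) * Q ^ i) :=
    Finset.prod_congr rfl fun i _ => by rw [pow_add]; ring
  -- Each prefactor (z;Q)_n splits at k. The parts below k cancel against the series: β, γ, t
  -- against its denominator, and -αQ^n, which equals the upper parameter ABQ^(n+1), against its
  -- numerator.
  rw [hβ, hγ, ht, hAB, e1, e2, e3, monicCoeff, e4, e5, qPoch_eq_mul_prod_Ico β Q hk,
    qPoch_eq_mul_prod_Ico γ Q hk, qPoch_eq_mul_prod_Ico t Q hk,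
    qPoch_eq_mul_prod_Ico (-(α * Q ^ n)) Q hk]
  have n1 := qPoch_ne_zero h1 hk
  have n2 := qPoch_ne_zero h2 hk
  have n3 := qPoch_ne_zero h3 hk
  have n4 := qPoch_ne_zero h4 hk
  generalize qPoch β Q k = p1 at *
  generalize qPoch γ Q k = p2 at *
  generalize qPoch t Q k = p3 at *
  generalize qPoch (-(α * Q ^ n)) Q k = p4 at *
  generalize ∏ i ∈ Finset.Ico k n, (1 - β * Q ^ i) = g1
  generalize ∏ i ∈ Finset.Ico k n, (1 - γ * Q ^ i) = g2
  generalize ∏ i ∈ Finset.Ico k n, (1 - t * Q ^ i) = g3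
  generalize ∏ i ∈ Finset.Ico k n, (1 - -(α * Q ^ n) * Q ^ i) = D
  generalize ∏ i ∈ Finset.range k, (1 - Q ^ i / Q ^ n) = H
  generalize ∏ i ∈ Finset.range k, (1 - Q ^ (i + 1)) = B'
  calc _ = (p1 / p1) * (p2 / p2) * (p3 / p3) * (p4 / p4) *
        (H * Q ^ k / B' * (g1 * g2 * g3 / D) * newtonBasis α β γ t Q X k) := by
        simp only [div_eq_mul_inv, mul_inv]; ring
    _ = _ := by rw [div_self n1, div_self n2, div_self n3, div_self n4]; ring

namespace UqSu2

theorem p_eq_racahPoly (q a b c : ℂ) (N x n : ℕ) (hq0 : q ≠ 0)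
    (hq : ∀ n : ℕ, 1 ≤ n → q ^ n ≠ 1) (ha : a ≠ 0) (hb : b ≠ 0)
    (hden : ∀ m : ℤ, -((N : ℤ) + 1) ≤ m → m ≤ (N : ℤ) + 2 → q ^ (2 * m) + a ≠ 0)
    (hbR : ∀ i : ℕ, i < N → b * q ^ (2 * (i : ℤ) + 1 - N) ≠ 1)
    (hcR : ∀ i : ℕ, i < N → c * q ^ (2 * (i : ℤ) + 1 - N) ≠ 1) (hn : n ≤ N) :
    p q a b c N x n = (q ^ N / (q - q⁻¹)) ^ n * racahPoly q a b c N (mu q a b c N x) n := by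
  have hw : q ^ N ≠ 0 := pow_ne_zero _ hq0
  have ht0 : q ^ (-2 * (N : ℤ)) = 1 / (q ^ N) ^ 2 := by
    rw [neg_mul, zpow_neg, show 2 * (N : ℤ) = ((N * 2 : ℕ) : ℤ) by push_cast; ring, zpow_natCast,
      pow_mul, one_div]
  have hβ (z : ℂ) : z * q ^ (1 - (N : ℤ)) = z * q / q ^ N := by
    rw [zpow_sub₀ hq0, zpow_one, zpow_natCast, mul_div_assoc]
  have hN1 : q ^ (-(N : ℤ) - 1) = 1 / (q ^ N * q) := by
    rw [zpow_sub₀ hq0, zpow_one, zpow_neg, zpow_natCast]; field_simp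
  have hN2 : q ^ (-2 - 2 * (N : ℤ)) = 1 / ((q ^ N) ^ 2 * q ^ 2) := by
    rw [zpow_sub₀ hq0, show 2 * (N : ℤ) = ((N * 2 : ℕ) : ℤ) by push_cast; ring, zpow_natCast,
      pow_mul]
    field_simp
  have hα : -a * q ^ (2 * (n : ℤ) - 2 * N) = -(a / (q ^ N) ^ 2 * (q ^ 2) ^ n) := by
    rw [zpow_sub₀ hq0, show 2 * (N : ℤ) = ((N * 2 : ℕ) : ℤ) by push_cast; ring,
      show 2 * (n : ℤ) = ((2 * n : ℕ) : ℤ) by push_cast; ring, zpow_natCast, zpow_natCast, pow_mul,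
      pow_mul]
    ring
  have hR (z : ℂ) (hz : ∀ i : ℕ, i < N → z * q ^ (2 * (i : ℤ) + 1 - N) ≠ 1) (i : ℕ) (hi : i < n) :
      z * q / q ^ N * (q ^ 2) ^ i ≠ 1 := by
    have := hz i (by omega)
    rw [zpow_sub₀ hq0, zpow_natCast, zpow_add₀ hq0, zpow_one,
      show 2 * (i : ℤ) = ((2 * i : ℕ) : ℤ) by push_cast; ring, zpow_natCast, pow_mul] at this
    intro h
    exact this (by rw [← h]; ring)
  rw [p, ht0, hβ, hβ, hα, pow_mul, ← div_pow, mul_assoc, racahPoly]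
  congr 1
  refine monicRacah_eq_qRacah _ _ _ _ _ _ _ _ _ _ n ?_ ?_ ?_ ?_ ?_ (hR b hbR) (hR c hcR) ?_ ?_
  · rw [hN1]; field_simp
  · rw [hN1]; field_simp
  · rw [hN2]; field_simp
  · rw [hN1, pow_succ]; field_simp
  · intro i
    rw [hN2, pow_succ (q ^ 2)]
    generalize (q ^ 2) ^ (2 * i) = u
    field_simp
  -- t Q^i = q^{2(i-N)}, which is not 1 for i < N because q is not a root of unity.
  · intro i hi h
    rw [one_div, inv_mul_eq_one₀ (pow_ne_zero _ hw), pow_right_comm,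
      ← Nat.add_sub_of_le (show i ≤ N by omega), pow_add,
      mul_eq_left₀ (pow_ne_zero _ (pow_ne_zero _ hq0)), ← pow_mul] at h
    exact hq _ (by omega) h
  · intro i hi h
    have := one_add_mul_pow_ne_zero (M := 2 * N + 2) (j := n + i)
      (fun j hj => sq_add_mul_pow_ne_zero hq0 hden hj) (by omega)
    rw [pow_add] at this
    exact this (by linear_combination -h)

/-! ### Eigenvectors and eigenvalues -/

/-- The superdiagonal entries are 1, so row m expresses g(m+1) through earlier values. Only rows m <
N are used; the last row is kept for the eigenvalue condition. -/
theorem eigenvector_eq (r q a b c : ℂ) (N : ℕ) (hr : r ^ 2 = q) (hq0 : q ≠ 0)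
    (hq : ∀ n : ℕ, 1 ≤ n → q ^ n ≠ 1) (hs : q - q⁻¹ ≠ 0) (ha : a ≠ 0)
    (hden : ∀ m : ℤ, -((N : ℤ) + 1) ≤ m → m ≤ (N : ℤ) + 2 → q ^ (2 * m) + a ≠ 0)
    (g : ℕ → ℂ) (X : ℂ)
    (h : ∀ n : Fin (N + 1), (Y r q a b c N *ᵥ fun i : Fin (N + 1) => g i) n =
      q ^ N / (q - q⁻¹) * X * g n) :
    ∀ n ≤ N, g n = g 0 * ((q ^ N / (q - q⁻¹)) ^ n * racahPoly q a b c N X n) := by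
  intro n
  induction n using Nat.strong_induction_on with
  | _ n ih =>
    intro hn
    rcases n with _ | m
    · simp [racahPoly, monicRacah_zero]
    have hm := h ⟨m, by omega⟩
    rw [Y_mulVec r q a b c N hr hq0 hs ha hden] at hm
    simp only [show m < N by omega, if_true] at hm
    have hrec := racahPoly_rec q a b c X N hq0 ha hq hden (show m ≤ N by omega)
    have i1 := ih m (by omega) (by omega)
    rcases m with _ | l
    · rw [lowerCoeff_zero] at hm hrec
      rw [i1] at hm
      linear_combination hm + q ^ N / (q - q⁻¹) * g 0 * hrec
    · have i2 := ih l (by omega) (by omega)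
      simp only [Nat.add_sub_cancel] at hm hrec
      rw [i1, i2] at hm
      linear_combination hm + (q ^ N / (q - q⁻¹)) ^ (l + 2) * g 0 * hrec

/-- For arbitrary X the candidate vector satisfies every row of the eigenvalue equation except the
last, whose defect is σ^{N+1} P_{N+1}(X). -/
theorem Y_mulVec_racahPoly (r q a b c : ℂ) (N : ℕ) (hr : r ^ 2 = q) (hq0 : q ≠ 0)
    (hq : ∀ n : ℕ, 1 ≤ n → q ^ n ≠ 1) (hs : q - q⁻¹ ≠ 0) (ha : a ≠ 0)
    (hden : ∀ m : ℤ, -((N : ℤ) + 1) ≤ m → m ≤ (N : ℤ) + 2 → q ^ (2 * m) + a ≠ 0)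
    (X : ℂ) (n : Fin (N + 1)) :
    (Y r q a b c N *ᵥ fun i : Fin (N + 1) =>
        (q ^ N / (q - q⁻¹)) ^ (i : ℕ) * racahPoly q a b c N X i) n +
      (if (n : ℕ) < N then 0 else (q ^ N / (q - q⁻¹)) ^ (N + 1) * racahPoly q a b c N X (N + 1)) =
      q ^ N / (q - q⁻¹) * X * ((q ^ N / (q - q⁻¹)) ^ (n : ℕ) * racahPoly q a b c N X n) := by
  have hrec := racahPoly_rec q a b c X N hq0 ha hq hden (show (n : ℕ) ≤ N by omega)
  rw [Y_mulVec r q a b c N hr hq0 hs ha hden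
    (fun i => (q ^ N / (q - q⁻¹)) ^ i * racahPoly q a b c N X i)]
  have e : (if (n : ℕ) < N then (q ^ N / (q - q⁻¹)) ^ ((n : ℕ) + 1) *
        racahPoly q a b c N X ((n : ℕ) + 1) else 0) +
      (if (n : ℕ) < N then 0 else (q ^ N / (q - q⁻¹)) ^ (N + 1) * racahPoly q a b c N X (N + 1)) =
      (q ^ N / (q - q⁻¹)) ^ ((n : ℕ) + 1) * racahPoly q a b c N X ((n : ℕ) + 1) := by
    split_ifs with hn
    · rw [add_zero]
    · rw [zero_add, show (n : ℕ) = N by omega]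
  generalize (n : ℕ) = m at *
  rcases m with _ | l
  · rw [lowerCoeff_zero] at *
    linear_combination e - q ^ N / (q - q⁻¹) * hrec
  · simp only [Nat.add_sub_cancel] at *
    linear_combination e - (q ^ N / (q - q⁻¹)) ^ (l + 2) * hrec

end UqSu2

theorem mainTheorem4 (N : ℕ) (r q a b c : ℂ) (hr : r ^ 2 = q) (hq0 : q ≠ 0)
    (hq : ∀ n : ℕ, 1 ≤ n → q ^ n ≠ 1) (ha : a ≠ 0) (hb : b ≠ 0)
    (hden : ∀ m : ℤ, -((N : ℤ) + 1) ≤ m → m ≤ (N : ℤ) + 2 → q ^ (2 * m) + a ≠ 0)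
    (hbR : ∀ i : ℕ, i < N → b * q ^ (2 * (i : ℤ) + 1 - N) ≠ 1)
    (hcR : ∀ i : ℕ, i < N → c * q ^ (2 * (i : ℤ) + 1 - N) ≠ 1) :
    (∀ x : ℕ, x ≤ N →
      (fun n : Fin (N + 1) => UqSu2.p q a b c N x n) ≠ 0 ∧
      UqSu2.Y r q a b c N *ᵥ (fun n : Fin (N + 1) => UqSu2.p q a b c N x n) =
        UqSu2.eigval q a b c N x • (fun n : Fin (N + 1) => UqSu2.p q a b c N x n)) ∧
    (∀ (ev : ℂ) (v : Fin (N + 1) → ℂ), v ≠ 0 → UqSu2.Y r q a b c N *ᵥ v = ev • v →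
      ∃ x : ℕ, x ≤ N ∧ ev = UqSu2.eigval q a b c N x ∧
        ∃ t : ℂ, t ≠ 0 ∧ v = t • (fun n : Fin (N + 1) => UqSu2.p q a b c N x n)) := by
  have hs : q - q⁻¹ ≠ 0 := by
    intro h
    refine hq 2 (by norm_num) ?_
    field_simp at h
    linear_combination h
  have hσ : q ^ N / (q - q⁻¹) ≠ 0 := div_ne_zero (pow_ne_zero _ hq0) hs
  have hp (x : ℕ) : (fun n : Fin (N + 1) => UqSu2.p q a b c N x n) = fun n : Fin (N + 1) =>
      (q ^ N / (q - q⁻¹)) ^ (n : ℕ) * UqSu2.racahPoly q a b c N (UqSu2.mu q a b c N x) n :=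
    funext fun n => UqSu2.p_eq_racahPoly q a b c N x n hq0 hq ha hb hden hbR hcR (by omega)
  have hev (x : ℕ) : UqSu2.eigval q a b c N x = q ^ N / (q - q⁻¹) * UqSu2.mu q a b c N x := by
    rw [UqSu2.eigval, div_mul_eq_mul_div]
  refine ⟨fun x hx => ⟨fun h => ?_, ?_⟩, fun ev v hv hY => ?_⟩
  -- The component at n = 0 is P_0 = 1.
  · rw [hp] at h
    have := congrFun h 0
    simp [UqSu2.racahPoly, monicRacah_zero] at this
  · rw [hp, hev]
    funext n
    have key := UqSu2.Y_mulVec_racahPoly r q a b c N hr hq0 hq hs ha hden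
      (UqSu2.mu q a b c N x) n
    rw [(UqSu2.racahPoly_top_eq_zero_iff q a b c _ N hq0 ha hq).2 ⟨x, hx, rfl⟩, mul_zero, ite_self,
      add_zero] at key
    exact key
  · obtain ⟨X, rfl⟩ : ∃ X, ev = q ^ N / (q - q⁻¹) * X := ⟨ev / (q ^ N / (q - q⁻¹)), (mul_div_cancel₀ _ hσ).symm⟩
    obtain ⟨g, rfl⟩ : ∃ g : ℕ → ℂ, v = fun i : Fin (N + 1) => g i :=
      ⟨fun n => if h : n < N + 1 then v ⟨n, h⟩ else 0, by
        funext i; simp only [i.isLt, dite_true]⟩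
    have hg := UqSu2.eigenvector_eq r q a b c N hr hq0 hq hs ha hden g X fun n => by
      rw [hY]; rfl
    have hg' : (fun i : Fin (N + 1) => g i) = g 0 • fun n : Fin (N + 1) =>
        (q ^ N / (q - q⁻¹)) ^ (n : ℕ) * UqSu2.racahPoly q a b c N X n :=
      funext fun n => hg n (by omega)
    have hg0 : g 0 ≠ 0 := by
      intro h0
      rw [h0, zero_smul] at hg'
      exact hv hg'
    -- Dividing the last row by g(0) ≠ 0 and comparing it with the general identity forces the
    -- defect to vanish.
    have htop : UqSu2.racahPoly q a b c N X (N + 1) = 0 := by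
      have key := UqSu2.Y_mulVec_racahPoly r q a b c N hr hq0 hq hs ha hden X (Fin.last N)
      have h := congrFun hY (Fin.last N)
      rw [hg', Matrix.mulVec_smul] at h
      simp only [Pi.smul_apply, smul_eq_mul, Fin.val_last] at h key
      rw [if_neg (lt_irrefl N)] at key
      have h' := mul_left_cancel₀ hg0 (h.trans (by ring :
        _ = g 0 * (q ^ N / (q - q⁻¹) * X *
          ((q ^ N / (q - q⁻¹)) ^ N * UqSu2.racahPoly q a b c N X N))))
      rw [h', add_eq_left] at key
      exact (mul_eq_zero.1 key).resolve_left (pow_ne_zero _ hσ)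
    obtain ⟨x, hx, rfl⟩ := (UqSu2.racahPoly_top_eq_zero_iff q a b c X N hq0 ha hq).1 htop
    exact ⟨x, hx, (hev x).symm, g 0, hg0, by rw [hp]; exact hg'⟩
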